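/- Let $f\in\mathbb{C}[[x,y]]$ be nonzero and such that the ring $\mathcal{O}=\mathbb{C}[[x,y]]/(f)$ is reduced. Let $M$ be a finitely generated torsion-free $\mathcal{O}$-module (i.e. every non-zero-divisor of $\mathcal{O}$ acts injectively on $M$), and let $M^D=\mathrm{Hom}_{\mathcal{O}}(M,\mathcal{O})$. Then $M^D$ is finitely generated, and $M$ and $M^D$ have the same minimal number of generators as $\mathcal{O}$-modules. -/

import Mathlib

/-- The complete local ring `ℂ⟦x, y⟧ / (f)` of a plane curve germ `f = 0`. -/
abbrev PlaneCurveRing (f : MvPowerSeries (Fin 2) ℂ) : Type :=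
  MvPowerSeries (Fin 2) ℂ ⧸ Ideal.span {f}

/-! Let `S = ℂ⟦x, y⟧`, `R = S ⧸ (f)`, with `f` a nonunit. Some linear form `t = x + c y` does not
divide `f`, so `t` is regular on `R` and hence on `M`. Take a minimal surjection `Rⁿ → M` and let `K
⊆ Sⁿ` be the preimage of its kernel. Torsion-freeness makes `K` saturated for `t`, and since `S ⧸
(t)` is a principal ideal ring, `K` is free. It contains `f Sⁿ`, so it has rank `n`, and a basis of
it gives a matrix factorization `φ ψ = ψ φ = f` with `M = coker φ` over `R`. The dual of `M` is then
`ker φᵀ = im ψᵀ`, generated by the `n` columns of `ψᵀ`. The relations between these columns form `im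
φᵀ`; by minimality `φ` has entries in the maximal ideal, so `n` generators are needed. -/

open IsLocalRing Pointwise in
/-- A submodule of `Sⁿ` over a Noetherian local domain is free as soon as it is saturated with
respect to a prime element `t` such that `S ⧸ (t)` is a principal ideal ring. -/
theorem Submodule.free_of_saturated_of_prime {S : Type*} [CommRing S] [IsDomain S] [IsLocalRing S]
    [IsNoetherianRing S] {n : ℕ} {t : S} (ht : Prime t)
    [IsPrincipalIdealRing (S ⧸ Ideal.span {t})] (K : Submodule S (Fin n → S))
    (hK : ∀ v : Fin n → S, t • v ∈ K → v ∈ K) : Module.Free S K := by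
  have hdom : IsDomain (S ⧸ Ideal.span {t}) := by
    rw [Ideal.Quotient.isDomain_iff_prime]
    exact (Ideal.span_singleton_prime ht.ne_zero).2 ht
  have : Module.FinitePresentation S K := Module.finitePresentation_of_finite S K
  have hmem : t ∈ (⊥ : Ideal S).jacobson :=
    maximalIdeal_le_jacobson _ ((mem_maximalIdeal t).2 ht.not_isUnit)
  have hreg : IsSMulRegular K t := fun a b h => smul_right_injective K ht.ne_zero h
  -- Freeness can be tested modulo the regular element `t`; over the PID `S ⧸ (t)`, torsion-freeness
  -- suffices.
  rw [← Module.free_quotSMulTop_iff_free S K hmem hreg]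
  have : Module.Finite (S ⧸ Ideal.span {t}) (QuotSMulTop t K) :=
    Module.Finite.of_restrictScalars_finite S _ _
  suffices Module.IsTorsionFree (S ⧸ Ideal.span {t}) (QuotSMulTop t K) from
    Module.free_of_finite_type_torsion_free'
  refine Module.IsTorsionFree.of_smul_eq_zero fun d q h => ?_
  obtain ⟨s, rfl⟩ := Ideal.Quotient.mk_surjective d
  obtain ⟨k, rfl⟩ := Submodule.mkQ_surjective _ q
  rw [or_iff_not_imp_left]
  intro hs
  rw [Ideal.Quotient.eq_zero_iff_mem, Ideal.mem_span_singleton] at hs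
  have h' : s • k ∈ t • (⊤ : Submodule S K) :=
    (Submodule.Quotient.mk_eq_zero _).1 h
  obtain ⟨k', -, hk'⟩ := (Submodule.mem_smul_pointwise_iff_exists _ _ _).1 h'
  have hdvd : ∀ i, t ∣ (k : Fin n → S) i := fun i =>
    (ht.dvd_or_dvd ⟨(k' : Fin n → S) i,
      (congrFun (congrArg Subtype.val hk') i).symm⟩).resolve_left hs
  choose w hw using hdvd
  have hkw : t • w = (k : Fin n → S) := funext fun i => (hw i).symm
  have hwK : w ∈ K := hK w (hkw ▸ k.2)
  refine (Submodule.Quotient.mk_eq_zero _).2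
    ((Submodule.mem_smul_pointwise_iff_exists _ _ _).2 ⟨⟨w, hwK⟩, trivial, Subtype.ext hkw⟩)

/-! ### Minimal generators over a local ring -/

open IsLocalRing in
/-- Over a local ring, a surjection from a free module whose kernel has coordinates in the maximal
ideal computes the minimal number of generators. -/
theorem IsLocalRing.spanFinrank_top_eq_of_ker_le {R N : Type*} [CommRing R] [IsLocalRing R]
    [AddCommGroup N] [Module R N] {n : ℕ} (p : (Fin n → R) →ₗ[R] N)
    (hp : Function.Surjective p) (hker : ∀ v, p v = 0 → ∀ i, v i ∈ maximalIdeal R) :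
    (⊤ : Submodule R N).spanFinrank = n := by
  have hn : (⊤ : Submodule R (Fin n → R)).spanFinrank = n := by
    rw [← Module.finrank_eq_spanFinrank_of_free, Module.finrank_fin_fun]
  have htop : (⊤ : Submodule R N) = (⊤ : Submodule R (Fin n → R)).map p := by
    rw [Submodule.map_top, LinearMap.range_eq_top.2 hp]
  have hfg : (⊤ : Submodule R N).FG := htop ▸ Module.Finite.fg_top.map p
  refine le_antisymm ?_ ?_
  · rw [htop]
    exact (Submodule.spanFinrank_map_le_of_fg p Module.Finite.fg_top).trans hn.le
  · obtain ⟨s, hs, hspan⟩ := hfg.exists_span_finset_card_eq_spanFinrank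
    classical
    choose g hg using hp
    have hmap : (Submodule.span R (g '' s)).map p = ⊤ := by
      rw [Submodule.map_span, Set.image_image]
      simpa [hg] using hspan
    have hsm : ∀ v : Fin n → R, (∀ i, v i ∈ maximalIdeal R) →
        v ∈ maximalIdeal R • (⊤ : Submodule R (Fin n → R)) := by
      intro v hv
      rw [pi_eq_sum_univ v]
      exact Submodule.sum_mem _ fun i _ => Submodule.smul_mem_smul (hv i) trivial
    -- Nakayama: lifts of generators of `N` span `Rⁿ` modulo `ker p`, which lies in `𝔪 Rⁿ`.
    have hle : (⊤ : Submodule R (Fin n → R)) ≤ Submodule.span R (g '' s) := by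
      refine Submodule.le_of_le_smul_of_le_jacobson_bot Module.Finite.fg_top
        (maximalIdeal_le_jacobson _) ?_
      intro v _
      have : p v ∈ (Submodule.span R (g '' s)).map p := hmap ▸ trivial
      obtain ⟨w, hw, hwv⟩ := this
      rw [← add_sub_cancel w v]
      exact Submodule.add_mem_sup hw (hsm _ (hker _ (by rw [map_sub, hwv, sub_self])))
    calc n = (Submodule.span R (g '' s)).spanFinrank := by rw [top_le_iff.1 hle, hn]
      _ ≤ (g '' (s : Set N)).ncard :=
        Submodule.spanFinrank_span_le_ncard_of_finite (s.finite_toSet.image g)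
      _ ≤ s.card := by
        rw [← Set.ncard_coe_finset s]
        exact Set.ncard_image_le s.finite_toSet
      _ = _ := hs

open IsLocalRing in
/-- A finite module over a local ring admits a surjection from a free module whose kernel has
coordinates in the maximal ideal. -/
theorem IsLocalRing.exists_surjective_ker_le (R N : Type*) [CommRing R] [IsLocalRing R]
    [AddCommGroup N] [Module R N] [Module.Finite R N] :
    ∃ (n : ℕ) (p : (Fin n → R) →ₗ[R] N), Function.Surjective p ∧
      ∀ v, p v = 0 → ∀ i, v i ∈ maximalIdeal R := by
  classical
  obtain ⟨s, hs, hspan⟩ :=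
    (Module.Finite.fg_top (R := R) (M := N)).exists_span_finset_card_eq_spanFinrank
  let e := s.equivFin.symm
  let x : Fin s.card → N := fun i => e i
  have hx : Set.range x = s := by
    ext y
    refine ⟨fun ⟨i, hi⟩ => hi ▸ (e i).2, fun hy => ⟨e.symm ⟨y, hy⟩, by simp [x]⟩⟩
  refine ⟨s.card, Fintype.linearCombination R x, ?_, ?_⟩
  · rw [← LinearMap.range_eq_top, Fintype.range_linearCombination, hx, hspan]
  · intro v hv i
    by_contra hi
    rw [mem_maximalIdeal, mem_nonunits_iff, not_not] at hi
    -- A relation with a unit coefficient makes `x i` redundant, against the minimality of `s`.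
    have hxi : x i ∈ Submodule.span R ((s.erase (x i) : Finset N) : Set N) := by
      obtain ⟨u, hu⟩ := hi
      rw [Fintype.linearCombination_apply, ← Finset.add_sum_erase _ _ (Finset.mem_univ i),
        ← hu] at hv
      have hxi : x i = (↑u⁻¹ : R) • -∑ j ∈ Finset.univ.erase i, v j • x j := by
        rw [← eq_neg_of_add_eq_zero_left hv, smul_smul, Units.inv_mul, one_smul]
      suffices (↑u⁻¹ : R) • -∑ j ∈ Finset.univ.erase i, v j • x j ∈
          Submodule.span R ((s.erase (x i) : Finset N) : Set N) by
        rwa [← hxi] at this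
      refine Submodule.smul_mem _ _ (Submodule.neg_mem _ (Submodule.sum_mem _ fun j hj => ?_))
      refine Submodule.smul_mem _ _ (Submodule.subset_span ?_)
      refine Finset.mem_coe.2 (Finset.mem_erase.2 ⟨fun h => ?_, (e j).2⟩)
      exact (Finset.mem_erase.1 hj).1 (e.injective (Subtype.ext h))
    have hspan' : Submodule.span R ((s.erase (x i) : Finset N) : Set N) = ⊤ := by
      rw [← top_le_iff, ← hspan, Submodule.span_le]
      intro y hy
      by_cases hyx : y = x i
      · exact hyx ▸ hxi
      · exact Submodule.subset_span (Finset.mem_coe.2 (Finset.mem_erase.2 ⟨hyx, hy⟩))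
    have hle := Submodule.spanFinrank_span_le_ncard_of_finite (R := R)
      (s.erase (x i)).finite_toSet
    rw [hspan', ← hs, Set.ncard_coe_finset] at hle
    exact absurd hle (not_le.2 (Finset.card_erase_lt_of_mem (e i).2))

/-! ### Linear forms in two-variable power series -/

namespace MvPowerSeries

theorem isPrincipalIdealRing_fin_one (k : Type*) [Field k] :
    IsPrincipalIdealRing (MvPowerSeries (Fin 1) k) := by
  have : IsPrincipalIdealRing (MvPowerSeries Unit k) :=
    inferInstanceAs (IsPrincipalIdealRing (PowerSeries k))
  exact IsPrincipalIdealRing.of_surjective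
    (renameEquiv k (Equiv.ofUnique Unit (Fin 1))).toRingEquiv.toRingHom
    (renameEquiv k (Equiv.ofUnique Unit (Fin 1))).surjective

theorem uniqueFactorizationMonoid_fin_two (k : Type*) [Field k] :
    UniqueFactorizationMonoid (MvPowerSeries (Fin 2) k) := by
  have := isPrincipalIdealRing_fin_one k
  have : IsDomain (MvPowerSeries (Fin 1) k) := NoZeroDivisors.to_isDomain _
  exact (finSuccEquiv k 1).symm.toMulEquiv.uniqueFactorizationMonoid inferInstance

theorem prime_X_zero (k : Type*) [Field k] : Prime (X 0 : MvPowerSeries (Fin 2) k) := by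
  have : IsDomain (MvPowerSeries (Fin 1) k) := NoZeroDivisors.to_isDomain _
  rw [← MulEquiv.prime_iff (finSuccEquiv k 1), finSuccEquiv_X_zero]
  exact PowerSeries.X_prime

theorem hasSubst_shear {k : Type*} [Field k] (c : k) :
    HasSubst (![X 0 + C c * X 1, X 1] : Fin 2 → MvPowerSeries (Fin 2) k) :=
  hasSubst_of_constantCoeff_zero fun i => by fin_cases i <;> simp

/-- The linear change of coordinates `X₀ ↦ X₀ + c X₁`. -/
noncomputable def shearHom {k : Type*} [Field k] (c : k) :
    MvPowerSeries (Fin 2) k →ₐ[k] MvPowerSeries (Fin 2) k :=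
  substAlgHom (hasSubst_shear c)

theorem shearHom_shearHom {k : Type*} [Field k] (c d : k) (h : c + d = 0)
    (f : MvPowerSeries (Fin 2) k) : shearHom c (shearHom d f) = f := by
  rw [shearHom, shearHom, substAlgHom_apply, substAlgHom_apply,
    subst_comp_subst_apply (hasSubst_shear d) (hasSubst_shear c)]
  conv_rhs => rw [← id_eq f, ← subst_self (σ := Fin 2) (R := k)]
  congr 1
  funext i
  fin_cases i
  · simp only [Fin.zero_eta, Matrix.cons_val_zero]
    rw [subst_add (hasSubst_shear c), subst_mul (hasSubst_shear c), subst_X (hasSubst_shear c),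
      subst_X (hasSubst_shear c), subst_C]
    simp [add_assoc, ← add_mul, ← map_add, h]
  · simp [subst_X (hasSubst_shear c)]

/-- The linear change of coordinates `X₀ ↦ X₀ + c X₁` as an automorphism. -/
noncomputable def shearEquiv {k : Type*} [Field k] (c : k) :
    MvPowerSeries (Fin 2) k ≃ₐ[k] MvPowerSeries (Fin 2) k :=
  AlgEquiv.ofAlgHom (shearHom c) (shearHom (-c))
    (AlgHom.ext fun f => shearHom_shearHom c (-c) (by simp) f)
    (AlgHom.ext fun f => shearHom_shearHom (-c) c (by simp) f)

theorem shearEquiv_X_zero {k : Type*} [Field k] (c : k) :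
    shearEquiv c (X 0) = X 0 + C c * X 1 := by
  simp [shearEquiv, shearHom, subst_X (hasSubst_shear c)]

theorem shearEquiv_X_one {k : Type*} [Field k] (c : k) :
    shearEquiv c (X 1) = X 1 := by
  simp [shearEquiv, shearHom, subst_X (hasSubst_shear c)]

theorem prime_X_zero_add {k : Type*} [Field k] (c : k) :
    Prime (X 0 + C c * X 1 : MvPowerSeries (Fin 2) k) := by
  rw [← shearEquiv_X_zero, MulEquiv.prime_iff (shearEquiv c)]
  exact prime_X_zero k

theorem isPrincipalIdealRing_quotient_X_zero (k : Type*) [Field k] :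
    IsPrincipalIdealRing
      (MvPowerSeries (Fin 2) k ⧸ Ideal.span {(X 0 : MvPowerSeries (Fin 2) k)}) := by
  have := isPrincipalIdealRing_fin_one k
  let q := Ideal.Quotient.mk (Ideal.span {(X 0 : MvPowerSeries (Fin 2) k)})
  refine IsPrincipalIdealRing.of_surjective
    (q.comp ((finSuccEquiv k 1).symm.toRingEquiv.toRingHom.comp PowerSeries.C)) fun y => ?_
  obtain ⟨g, rfl⟩ := Ideal.Quotient.mk_surjective y
  refine ⟨PowerSeries.constantCoeff (finSuccEquiv k 1 g), ?_⟩
  change q ((finSuccEquiv k 1).symm (PowerSeries.C _)) = q g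
  rw [Ideal.Quotient.eq, Ideal.mem_span_singleton]
  rw [← map_dvd_iff (finSuccEquiv k 1), finSuccEquiv_X_zero, PowerSeries.X_dvd_iff]
  simp

theorem isPrincipalIdealRing_quotient_X_zero_add {k : Type*} [Field k] (c : k) :
    IsPrincipalIdealRing
      (MvPowerSeries (Fin 2) k ⧸ Ideal.span {(X 0 + C c * X 1 : MvPowerSeries (Fin 2) k)}) := by
  have := isPrincipalIdealRing_quotient_X_zero k
  let e := Ideal.quotientEquiv (Ideal.span {(X 0 : MvPowerSeries (Fin 2) k)})
    (Ideal.span {(X 0 + C c * X 1 : MvPowerSeries (Fin 2) k)}) (shearEquiv c).toRingEquiv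
    (by rw [Ideal.map_span]; simp [shearEquiv_X_zero])
  exact IsPrincipalIdealRing.of_surjective e.toRingHom e.surjective

theorem isRelPrime_X_zero_add {k : Type*} [Field k] {c d : k} (h : c ≠ d) :
    IsRelPrime (X 0 + C c * X 1 : MvPowerSeries (Fin 2) k) (X 0 + C d * X 1) := by
  refine ((prime_X_zero_add c).irreducible.isRelPrime_iff_not_dvd).2 fun hdvd => ?_
  have h1 : X 0 + C c * X 1 ∣ C (d - c) * (X 1 : MvPowerSeries (Fin 2) k) := by
    convert dvd_sub hdvd dvd_rfl using 1
    rw [map_sub]; ring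
  have hu : IsUnit (C (d - c) : MvPowerSeries (Fin 2) k) :=
    (isUnit_iff_ne_zero.2 (sub_ne_zero.2 h.symm)).map C
  rw [hu.dvd_mul_left] at h1
  -- Undoing the shear reduces the claim to `X 0 ∤ X 1`.
  rw [← shearEquiv_X_zero, ← shearEquiv_X_one c, map_dvd_iff (shearEquiv c), X_dvd_iff] at h1
  have := h1 (Finsupp.single 1 1) (by simp)
  simp [coeff_X] at this

/-- A nonzero power series in two variables is not divisible by some `X₀ + c X₁`. -/
theorem exists_not_X_zero_add_dvd {k : Type*} [Field k] [Infinite k]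
    {f : MvPowerSeries (Fin 2) k} (hf : f ≠ 0) : ∃ c : k, ¬ X 0 + C c * X 1 ∣ f := by
  by_contra! hall
  have := uniqueFactorizationMonoid_fin_two k
  obtain ⟨m, hm⟩ := ENat.ne_top_iff_exists.1 (mt order_eq_top_iff.1 hf)
  -- The product of `m + 1` coprime linear forms would divide `f`, but has order greater than `m =
  -- f.order`.
  obtain ⟨s, hs⟩ := Infinite.exists_subset_card_eq k (m + 1)
  obtain ⟨g, hg⟩ : ∏ c ∈ s, (X 0 + C c * X 1) ∣ f :=
    Finset.prod_dvd_of_isRelPrime (fun c _ d _ h => isRelPrime_X_zero_add h) fun c _ => hall c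
  have hle : ((m + 1 : ℕ) : ℕ∞) ≤ f.order := by
    rw [hg, order_mul, order_prod, ← hs, Finset.card_eq_sum_ones, Nat.cast_sum]
    refine le_add_right (Finset.sum_le_sum fun c _ => ?_)
    rw [Nat.cast_one, one_le_order_iff_constCoeff_eq_zero]
    simp
  rw [← hm, Nat.cast_le] at hle
  omega

end MvPowerSeries

/-! ### Matrix factorizations -/

open Matrix in
/-- A saturated submodule of `Sⁿ` containing `f Sⁿ` is the column space of a matrix factorization
of `f`. -/
theorem Submodule.exists_matrix_factorization {S : Type*} [CommRing S] [IsDomain S]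
    [IsLocalRing S] [IsNoetherianRing S] {n : ℕ} {t : S} (ht : Prime t)
    [IsPrincipalIdealRing (S ⧸ Ideal.span {t})] (K : Submodule S (Fin n → S))
    (hK : ∀ v : Fin n → S, t • v ∈ K → v ∈ K) {f : S} (hf : f ≠ 0)
    (hfK : ∀ v : Fin n → S, f • v ∈ K) :
    ∃ φ ψ : Matrix (Fin n) (Fin n) S, φ * ψ = f • 1 ∧ ψ * φ = f • 1 ∧
      ∀ v, v ∈ K ↔ ∃ u, φ *ᵥ u = v := by
  have hfree := K.free_of_saturated_of_prime ht hK
  have hrank : Module.finrank S K = n := by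
    refine le_antisymm ?_ ?_
    · simpa using LinearMap.finrank_le_finrank_of_injective K.injective_subtype
    -- Multiplication by `f` embeds `Sⁿ` in `K`, so the rank is at least `n`.
    · let g : (Fin n → S) →ₗ[S] K := (LinearMap.lsmul S (Fin n → S) f).codRestrict K hfK
      have hg : Function.Injective g := fun a b h =>
        smul_right_injective _ hf (congrArg Subtype.val h)
      simpa using LinearMap.finrank_le_finrank_of_injective hg
  let b : Module.Basis (Fin n) S K := Module.finBasisOfFinrankEq S K hrank
  let φ : Matrix (Fin n) (Fin n) S := of fun i j => (b j : Fin n → S) i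
  have hφ : ∀ u, φ *ᵥ u = (b.equivFun.symm u : K) := by
    intro u
    ext i
    simp [φ, mulVec, dotProduct, Module.Basis.equivFun_symm_apply, mul_comm]
  let ψ : Matrix (Fin n) (Fin n) S :=
    of fun i j => b.equivFun ⟨f • Pi.single j 1, hfK _⟩ i
  have hφψ : φ * ψ = f • 1 := by
    refine Matrix.ext_of_mulVec_single fun j => ?_
    have hcol : ψ *ᵥ Pi.single j 1 = b.equivFun ⟨f • Pi.single j 1, hfK _⟩ := by
      ext i
      simp [ψ]
    rw [← mulVec_mulVec, hcol, hφ, LinearEquiv.symm_apply_apply, smul_mulVec, one_mulVec]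
  have hinj : Function.Injective φ.mulVec := fun u v h => by
    rw [hφ, hφ] at h
    exact b.equivFun.symm.injective (Subtype.ext h)
  refine ⟨φ, ψ, hφψ, ?_, fun v => ⟨fun hv => ⟨b.equivFun ⟨v, hv⟩, by simp [hφ]⟩, ?_⟩⟩
  -- From `φ (ψ φ) = f φ = φ f`, cancel the injective `φ`.
  · refine Matrix.ext_of_mulVec_single fun j => hinj ?_
    rw [mulVec_mulVec, ← mul_assoc, hφψ, ← mulVec_mulVec, smul_mulVec, smul_mulVec, one_mulVec,
      one_mulVec, mulVec_smul]
  · rintro ⟨u, rfl⟩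
    rw [hφ]
    exact Subtype.prop _

open Matrix in
/-- If `φ ψ = f = ψ φ` with `f ≠ 0` in a domain `S`, then the kernel of `φ` over `S ⧸ (f)` is the
image of `ψ`. -/
theorem Matrix.exists_mulVec_eq_of_factorization {S : Type*} [CommRing S] [IsDomain S] {n : ℕ}
    {f : S} (hf : f ≠ 0) {φ ψ : Matrix (Fin n) (Fin n) S} (h₁ : φ * ψ = f • 1)
    (h₂ : ψ * φ = f • 1) (v : Fin n → S ⧸ Ideal.span {f}) :
    φ.map (Ideal.Quotient.mk (Ideal.span {f})) *ᵥ v = 0 ↔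
      ∃ u, ψ.map (Ideal.Quotient.mk (Ideal.span {f})) *ᵥ u = v := by
  set q := Ideal.Quotient.mk (Ideal.span {f})
  have hq : ∀ (A : Matrix (Fin n) (Fin n) S) (x : Fin n → S),
      A.map q *ᵥ (q ∘ x) = q ∘ (A *ᵥ x) :=
    fun A x => (funext fun i => RingHom.map_mulVec q A x i).symm
  constructor
  · intro h
    obtain ⟨x, rfl⟩ : ∃ x, q ∘ x = v := by
      choose x hx using fun i => Ideal.Quotient.mk_surjective (v i)
      exact ⟨x, funext hx⟩
    rw [hq] at h
    have hdvd : ∀ i, f ∣ (φ *ᵥ x) i := fun i =>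
      Ideal.mem_span_singleton.1 (Ideal.Quotient.eq_zero_iff_mem.1 (congrFun h i))
    choose u hu using hdvd
    have hu' : φ *ᵥ x = f • u := funext hu
    refine ⟨q ∘ u, ?_⟩
    rw [hq]
    congr 1
    -- From `φ x = f u` follows `f ψ u = ψ φ x = f x`, and `f` cancels in `S`.
    apply smul_right_injective _ hf
    change f • (ψ *ᵥ u) = f • x
    rw [← mulVec_smul, ← hu', mulVec_mulVec, h₂, smul_mulVec, one_mulVec]
  · rintro ⟨u, rfl⟩
    rw [mulVec_mulVec, ← Matrix.map_mul, h₁]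
    have : (f • (1 : Matrix (Fin n) (Fin n) S)).map q = 0 := by
      ext i j
      rw [map_apply, smul_apply, smul_eq_mul, map_mul,
        Ideal.Quotient.eq_zero_iff_mem.2 (Ideal.mem_span_singleton_self f), zero_mul, zero_apply]
    rw [this, zero_mulVec]

/-! ### Generators of the dual module -/

open IsLocalRing Matrix in
/-- If `M` is the cokernel of a square matrix `φ` with entries in the maximal ideal, and the
transpose of `φ` fits into a two-periodic exact sequence with the transpose of `ψ`, then the dual
of `M` needs as many generators as `M`. -/
theorem IsLocalRing.spanFinrank_dual_eq {R M : Type*} [CommRing R] [IsLocalRing R]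
    [AddCommGroup M] [Module R M] {n : ℕ} (p : (Fin n → R) →ₗ[R] M)
    (hp : Function.Surjective p) {φ ψ : Matrix (Fin n) (Fin n) R}
    (hφ : ∀ i j, φ i j ∈ maximalIdeal R) (hker : ∀ v, p v = 0 ↔ ∃ u, φ *ᵥ u = v)
    (hφψ : ∀ v, φᵀ *ᵥ v = 0 ↔ ∃ u, ψᵀ *ᵥ u = v) (hψφ : ∀ v, ψᵀ *ᵥ v = 0 ↔ ∃ u, φᵀ *ᵥ u = v) :
    (⊤ : Submodule R (M →ₗ[R] R)).spanFinrank = n := by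
  let j : (M →ₗ[R] R) →ₗ[R] (Fin n → R) :=
    LinearMap.pi fun i => LinearMap.applyₗ (p (Pi.single i 1))
  have hj : ∀ g v, g (p v) = j g ⬝ᵥ v := by
    intro g v
    conv_lhs => rw [pi_eq_sum_univ' v]
    simp [j, dotProduct, mul_comm]
  have hjinj : Function.Injective j := fun g h hgh => by
    refine LinearMap.ext fun m => ?_
    obtain ⟨v, rfl⟩ := hp m
    rw [hj, hj, hgh]
  -- A functional on `M` is a row vector killing the columns of `φ`, that is, an element of `ker
  -- φᵀ`.
  have hjrange : LinearMap.range j = LinearMap.range ψᵀ.mulVecLin := by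
    ext a
    rw [LinearMap.mem_range, LinearMap.mem_range]
    simp only [mulVecLin_apply]
    rw [← hφψ]
    constructor
    · rintro ⟨g, rfl⟩
      ext i
      rw [mulVec_transpose, ← dotProduct_single_one (j g ᵥ* φ) i, ← dotProduct_mulVec, ← hj,
        (hker _).2 ⟨_, rfl⟩, map_zero, Pi.zero_apply]
    · intro ha
      let ℓ : (Fin n → R) →ₗ[R] R := dotProductBilin R R a
      have hℓ : LinearMap.ker p ≤ LinearMap.ker ℓ := by
        intro v hv
        obtain ⟨u, rfl⟩ := (hker v).1 hv
        change a ⬝ᵥ φ *ᵥ u = 0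
        rw [dotProduct_mulVec, ← mulVec_transpose, ha, zero_dotProduct]
      refine ⟨(LinearMap.ker p).liftQ ℓ hℓ ∘ₗ (p.quotKerEquivOfSurjective hp).symm.toLinearMap, ?_⟩
      ext i
      have : (p.quotKerEquivOfSurjective hp).symm (p (Pi.single i 1)) =
          (LinearMap.ker p).mkQ (Pi.single i 1) := by
        rw [LinearEquiv.symm_apply_eq]; rfl
      simp [j, this, ℓ]
  rw [← Submodule.spanFinrank_map_eq_of_injective j hjinj, Submodule.map_top, hjrange,
    ← Submodule.spanFinrank_top]
  refine spanFinrank_top_eq_of_ker_le ψᵀ.mulVecLin.rangeRestrict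
    (LinearMap.surjective_rangeRestrict _) fun v hv i => ?_
  obtain ⟨u, rfl⟩ := (hψφ v).1 (congrArg Subtype.val hv)
  change ∑ k, φ k i * u k ∈ _
  exact Ideal.sum_mem _ fun k _ => Ideal.mul_mem_right _ _ (hφ k i)

open IsLocalRing Matrix in
/-- Let `S` be a Noetherian local domain with a prime element `t` such that `S ⧸ (t)` is a principal
ideal ring, and let `f ≠ 0` be a nonunit not divisible by `t`. A finite torsion-free module over
`S ⧸ (f)` has as many minimal generators as its dual. -/
theorem Ideal.Quotient.spanFinrank_dual_eq_of_isTorsionFree {S : Type*} [CommRing S] [IsDomain S]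
    [IsLocalRing S] [IsNoetherianRing S] {t f : S} (ht : Prime t)
    [IsPrincipalIdealRing (S ⧸ Ideal.span {t})] (hf : f ≠ 0) (hfu : ¬ IsUnit f) (htf : ¬ t ∣ f)
    (M : Type*) [AddCommGroup M] [Module (S ⧸ Ideal.span {f}) M]
    [Module.Finite (S ⧸ Ideal.span {f}) M] [Module.IsTorsionFree (S ⧸ Ideal.span {f}) M] :
    (⊤ : Submodule (S ⧸ Ideal.span {f}) (M →ₗ[S ⧸ Ideal.span {f}] S ⧸ Ideal.span {f})).spanFinrank =
      (⊤ : Submodule (S ⧸ Ideal.span {f}) M).spanFinrank := by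
  set q := Ideal.Quotient.mk (Ideal.span {f})
  have hq0 : ∀ {x}, q x = 0 ↔ f ∣ x := fun {x} => by
    rw [Ideal.Quotient.eq_zero_iff_mem, Ideal.mem_span_singleton]
  have : Nontrivial (S ⧸ Ideal.span {f}) :=
    Ideal.Quotient.nontrivial_iff.2 (mt Ideal.span_singleton_eq_top.1 hfu)
  have : IsLocalRing (S ⧸ Ideal.span {f}) := .of_surjective' q Ideal.Quotient.mk_surjective
  obtain ⟨n, p, hp, hker⟩ := exists_surjective_ker_le (S ⧸ Ideal.span {f}) M
  have hreg : IsRegular (q t) := by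
    rw [isRegular_iff_mem_nonZeroDivisors, mem_nonZeroDivisors_iff_right]
    intro x hx
    obtain ⟨x, rfl⟩ := Ideal.Quotient.mk_surjective x
    obtain ⟨y, hy⟩ := hq0.1 ((map_mul q x t).trans hx)
    obtain ⟨z, rfl⟩ := (ht.dvd_or_dvd ⟨x, hy.symm.trans (mul_comm _ _)⟩).resolve_left htf
    refine hq0.2 ⟨z, mul_right_cancel₀ ht.ne_zero ?_⟩
    rw [hy]; ring
  let K : Submodule S (Fin n → S) :=
    { carrier := {v | p (q ∘ v) = 0}
      zero_mem' := by
        have : q ∘ (0 : Fin n → S) = 0 := funext fun i => map_zero q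
        simp [this]
      add_mem' := fun {a b} ha hb => by
        have : q ∘ (a + b) = q ∘ a + q ∘ b := funext fun i => map_add q _ _
        change p _ = 0
        rw [this, map_add, ha, hb, add_zero]
      smul_mem' := fun c a ha => by
        have : q ∘ (c • a) = q c • (q ∘ a) := funext fun i => map_mul q _ _
        change p _ = 0
        rw [this, map_smul, ha, smul_zero] }
  have hKt : ∀ v : Fin n → S, t • v ∈ K → v ∈ K := fun v hv => by
    have : q ∘ (t • v) = q t • (q ∘ v) := funext fun i => map_mul q _ _
    change p _ = 0 at hv
    rw [this, map_smul] at hv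
    exact hreg.smul_eq_zero_iff_right.1 hv
  have hKf : ∀ v : Fin n → S, f • v ∈ K := fun v => by
    have : q ∘ (f • v) = 0 := funext fun i => hq0.2 (dvd_mul_right f (v i))
    change p _ = 0
    rw [this, map_zero]
  obtain ⟨φ, ψ, h₁, h₂, hφ⟩ := K.exists_matrix_factorization ht hKt hf hKf
  have hq : ∀ (x : Fin n → S), φ.map q *ᵥ (q ∘ x) = q ∘ (φ *ᵥ x) :=
    fun x => (funext fun i => RingHom.map_mulVec q φ x i).symm
  have hlift : ∀ v : Fin n → S ⧸ Ideal.span {f}, ∃ x, q ∘ x = v := fun v => by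
    choose x hx using fun i => Ideal.Quotient.mk_surjective (v i)
    exact ⟨x, funext hx⟩
  have hker' : ∀ v, p v = 0 ↔ ∃ u, φ.map q *ᵥ u = v := by
    intro v
    constructor
    · obtain ⟨x, rfl⟩ := hlift v
      intro hx
      obtain ⟨u, rfl⟩ := (hφ x).1 hx
      exact ⟨q ∘ u, hq u⟩
    · rintro ⟨u, rfl⟩
      obtain ⟨x, rfl⟩ := hlift u
      rw [hq]
      exact (hφ _).2 ⟨x, rfl⟩
  -- The columns of `φ` lie in `ker p`, so minimality of `p` bounds their entries.
  have hφm : ∀ i j, φ.map q i j ∈ maximalIdeal (S ⧸ Ideal.span {f}) := fun i j => by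
    have := hker _ ((hker' _).2 ⟨Pi.single j 1, rfl⟩) i
    rwa [mulVec_single_one] at this
  have h₁' : φᵀ * ψᵀ = f • 1 := by rw [← transpose_mul, h₂, transpose_smul, transpose_one]
  have h₂' : ψᵀ * φᵀ = f • 1 := by rw [← transpose_mul, h₁, transpose_smul, transpose_one]
  rw [spanFinrank_top_eq_of_ker_le p hp hker]
  exact spanFinrank_dual_eq p hp hφm hker'
    (exists_mulVec_eq_of_factorization hf h₁' h₂')
    (exists_mulVec_eq_of_factorization hf h₂' h₁')

theorem mainTheorem7 (f : MvPowerSeries (Fin 2) ℂ) (hf : f ≠ 0)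
    (hred : IsReduced (PlaneCurveRing f))
    (M : Type*) [AddCommGroup M] [Module (PlaneCurveRing f) M]
    [Module.Finite (PlaneCurveRing f) M] [Module.IsTorsionFree (PlaneCurveRing f) M] :
    Module.Finite (PlaneCurveRing f) (M →ₗ[PlaneCurveRing f] PlaneCurveRing f) ∧
      (⊤ : Submodule (PlaneCurveRing f) (M →ₗ[PlaneCurveRing f] PlaneCurveRing f)).spanFinrank =
        (⊤ : Submodule (PlaneCurveRing f) M).spanFinrank := by
  refine ⟨inferInstance, ?_⟩
  by_cases hfu : IsUnit f
  · have : Subsingleton (PlaneCurveRing f) :=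
      Ideal.Quotient.subsingleton_iff.2 (Ideal.span_singleton_eq_top.2 hfu)
    rw [Submodule.spanFinrank_subsingleton, Submodule.spanFinrank_subsingleton]
  · have : IsDomain (MvPowerSeries (Fin 2) ℂ) := NoZeroDivisors.to_isDomain _
    obtain ⟨c, hc⟩ := MvPowerSeries.exists_not_X_zero_add_dvd hf
    have := MvPowerSeries.isPrincipalIdealRing_quotient_X_zero_add c
    exact Ideal.Quotient.spanFinrank_dual_eq_of_isTorsionFree (MvPowerSeries.prime_X_zero_add c)
      hf hfu hc M
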